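/- All monoids are commutative (no zero element is required). For a monoid $M$, a prime ideal is a subset $\mathfrak p\subset M$ (possibly empty) with $M\mathfrak p\subseteq\mathfrak p$ whose complement is a submonoid; $\mathrm{Spec}(M)$ is the set of prime ideals with the topology with basis $D(f)=\{\mathfrak p : f\notin\mathfrak p\}$ and the sheaf of monoids $\mathcal O_M$ whose sections are the functions $\mathfrak p\mapsto s(\mathfrak p)\in M_{\mathfrak p}$ that are locally given by a fraction, so that $\mathcal O_M(D(f))=M_f$. A monoid scheme is a space $X$ with a sheaf of monoids $\mathcal O_X$ that is locally isomorphic to some $(\mathrm{Spec}(M),\mathcal O_M)$; a morphism is a morphism of spaces with sheaves of monoids whose maps on stalks reflect invertible elements. A morphism $f:Z\to Y$ is a closed immersion if $Y$ is covered by affine open $U$ such that $f^{-1}(U)$ is empty or affine and $\mathcal O_Y(U)\to\mathcal O_Z(f^{-1}(U))$ is surjective, and $X$ is separated if its diagonal $X\to X\times X$ is a closed immersion. An $\mathcal O_X$-set is a sheaf of sets on $X$ with an action of $\mathcal O_X$; morphisms are the equivariant morphisms of sheaves. A vector bundle of rank $n\ge 0$ on $X$ is an $\mathcal O_X$-set which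 is locally on $X$ isomorphic to the coproduct $\mathcal O_X^{\coprod n}$ of $n$ copies of $\mathcal O_X$ (coproducts are taken in the category of $\mathcal O_X$-sets); a line bundle is a vector bundle of rank $1$. Let $\mathrm{Vect}_n(X)$ be the set of isomorphism classes of vector bundles of rank $n$ and $\mathrm{Pic}(X)=\mathrm{Vect}_1(X)$. **Theorem.** Let $X$ be a connected (in particular non-empty) separated monoid scheme and $n\ge 0$. 1. Every vector bundle of rank $n$ on $X$ is a coproduct of $n$ line bundles. 2. The decomposition is unique up to permuting the summands: if $L_1,\dots,L_n$ and $L'_1,\dots,L'_n$ are line bundles and $\mathcal V$ is a coproduct of the $L_i$ and also of the $L'_i$, then there is a permutation $\sigma\in\Sigma_n$ with $L'_i\cong L_{\sigma(i)}$ for all $i$. 3. The coproduct induces a bijection $\mathrm{Pic}(X)^n/\Sigma_n\to \mathrm{Vect}_n(X)$, where $\Sigma_n$ permutes the factors: there is a bijection $e$ between these sets such that, for all line bundles $L_1,\dots,L_n$ and every vector bundle $\mathcal V$ of rank $n$, $e$ sends the orbit of $([L_1],\dots,[L_n])$ to $[\mathcal V]$ if and only if $\mathcal V$ is a coproduct of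 $L_1,\dots,L_n$. -/

import Mathlib

open CategoryTheory TopologicalSpace Opposite

universe u

namespace MonoidGeom

section Spectrum

/-- A prime ideal of a commutative monoid `M`: a subset `𝔭` with `M𝔭 ⊆ 𝔭` whose complement is a
submonoid.  The empty set is a prime ideal; `M` itself is not. -/
@[ext]
structure PrimeIdeal (M : Type u) [CommMonoid M] where
  carrier : Set M
  mul_mem_left : ∀ a b : M, b ∈ carrier → a * b ∈ carrier
  one_notMem : (1 : M) ∉ carrier
  mem_or_mem : ∀ a b : M, a * b ∈ carrier → a ∈ carrier ∨ b ∈ carrier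

variable (M : Type u) [CommMonoid M]

/-- The complement of a prime ideal, as a submonoid. -/
def PrimeIdeal.primeCompl {M : Type u} [CommMonoid M] (p : PrimeIdeal M) : Submonoid M where
  carrier := p.carrierᶜ
  mul_mem' ha hb h := (p.mem_or_mem _ _ h).elim ha hb
  one_mem' := p.one_notMem

/-- The basic open set `D(f)` of primes that do not contain `f`. -/
def basicOpen {M : Type u} [CommMonoid M] (f : M) : Set (PrimeIdeal M) := {p | f ∉ p.carrier}

/-- The topology on the set of primes generated by the sets `D(f)`; they form a basis, because
`D(f) ∩ D(g) = D(fg)` and `D(1)` is everything. -/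
instance : TopologicalSpace (PrimeIdeal M) :=
  TopologicalSpace.generateFrom (Set.range basicOpen)

/-- The spectrum of `M` as a topological space. -/
def specTop : TopCat.{u} := TopCat.of (PrimeIdeal M)

/-- The stalk `M_𝔭` of the structure sheaf. -/
abbrev StalkAt (p : specTop M) : Type u := Localization (PrimeIdeal.primeCompl (M := M) p)

/-- Families of elements of the `M_𝔭` that are given by one fraction `a / b`. -/
def isFractionPrelocal : TopCat.PrelocalPredicate (StalkAt M) where
  pred {U} f := ∃ a b : M, ∀ x : U, ∃ hb : b ∈ PrimeIdeal.primeCompl (M := M) x.1,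
    f x = Localization.mk a ⟨b, hb⟩
  res := by
    rintro V U i f ⟨a, b, w⟩
    exact ⟨a, b, fun x => w (i x)⟩

/-- Families of elements of the `M_𝔭` that are locally given by one fraction `a / b`. -/
def isLocallyFraction : TopCat.LocalPredicate (StalkAt M) :=
  (isFractionPrelocal M).sheafify

/-- The sections of the structure sheaf of `Spec M` over `U`: functions `𝔭 ↦ s(𝔭) ∈ M_𝔭` that
are locally a fraction. -/
def sectionsSubmonoid (U : Opens (specTop M)) : Submonoid (∀ x : U, StalkAt M x.1) where
  carrier := {f | (isLocallyFraction M).pred f}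
  one_mem' x := ⟨U, x.2, 𝟙 _, 1, 1, fun _ => ⟨Submonoid.one_mem _, Localization.mk_one.symm⟩⟩
  mul_mem' {f g} hf hg x := by
    obtain ⟨V, hV, i, a, b, h⟩ := hf x
    obtain ⟨W, hW, j, c, d, k⟩ := hg x
    refine ⟨V ⊓ W, ⟨hV, hW⟩, Opens.infLELeft _ _ ≫ i, a * c, b * d, fun y => ?_⟩
    obtain ⟨hb, e₁⟩ := h ⟨y.1, y.2.1⟩
    obtain ⟨hd, e₂⟩ := k ⟨y.1, y.2.2⟩
    exact ⟨Submonoid.mul_mem _ hb hd, congr($e₁ * $e₂).trans (Localization.mk_mul ..)⟩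

/-- The structure sheaf of `Spec M`, as a presheaf of commutative monoids. -/
def specPresheaf : TopCat.Presheaf CommMonCat.{u} (specTop M) where
  obj U := CommMonCat.of (sectionsSubmonoid M U.unop)
  map {U V} i := CommMonCat.ofHom
    { toFun := fun s => ⟨fun x => s.1 (i.unop x), (isLocallyFraction M).res i.unop s.1 s.2⟩
      map_one' := rfl
      map_mul' := fun _ _ => rfl }

/-- The affine monoid scheme `(Spec M, 𝒪_M)`, as a space with a sheaf of commutative monoids. -/
def specSpace : AlgebraicGeometry.SheafedSpace.{u + 1, u, u} CommMonCat.{u} where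
  carrier := specTop M
  presheaf := specPresheaf M
  IsSheaf := (TopCat.Presheaf.isSheaf_iff_isSheaf_comp (forget CommMonCat.{u}) _).mpr
    (TopCat.Presheaf.isSheaf_of_iso
      (NatIso.ofComponents (fun _ => Iso.refl _) :
        (TopCat.subsheafToTypes (isLocallyFraction M)).1 ≅ specPresheaf M ⋙ forget CommMonCat.{u})
      (TopCat.subsheafToTypes (isLocallyFraction M)).2)

end Spectrum

/-- A space with a sheaf of commutative monoids. -/
abbrev MonoidedSpace := AlgebraicGeometry.SheafedSpace.{u + 1, u, u} CommMonCat.{u}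

/-- The open subspace `U` of `X`, with the restricted sheaf of monoids. -/
noncomputable abbrev MonoidedSpace.onOpen (X : MonoidedSpace.{u}) (U : Opens X.carrier) :
    MonoidedSpace.{u} :=
  AlgebraicGeometry.SheafedSpace.restrict X U.isOpenEmbedding

/-- `U` is isomorphic to `Spec M` for some commutative monoid `M`.  An isomorphism induces
isomorphisms of stalks, so it is automatically local. -/
def IsAffineOpen (X : MonoidedSpace.{u}) (U : Opens X.carrier) : Prop :=
  ∃ M : CommMonCat.{u}, Nonempty (MonoidedSpace.onOpen X U ≅ specSpace M)

/-- The germ at `x` of the section `s ∈ 𝒪_X(V)` is invertible in the stalk, that is, `s` becomes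
invertible on some open neighbourhood of `x`. -/
def IsUnitAt (X : MonoidedSpace.{u}) {V : Opens X.carrier} (s : X.presheaf.obj (op V))
    (x : X.carrier) : Prop :=
  ∃ (W : Opens X.carrier) (i : W ⟶ V), x ∈ W ∧ IsUnit (X.presheaf.map i.op s)

/-- `f` is local: at each point `x` the map of stalks `𝒪_{Y,f(x)} → 𝒪_{X,x}` reflects invertible
elements. -/
def IsLocalMorphism {X Y : MonoidedSpace.{u}} (f : X ⟶ Y) : Prop :=
  ∀ (x : X.carrier) (V : Opens Y.carrier) (s : Y.presheaf.obj (op V)), f.hom.base x ∈ V →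
    IsUnitAt X (f.hom.c.app (op V) s : X.presheaf.obj (op ((Opens.map f.hom.base).obj V))) x →
    IsUnitAt Y s (f.hom.base x)

/-- A monoid scheme: a space with a sheaf of commutative monoids that is locally isomorphic to
`(Spec M, 𝒪_M)`. -/
structure MonoidScheme where
  toSpace : MonoidedSpace.{u}
  exists_affine : ∀ x : toSpace.carrier, ∃ U : Opens toSpace.carrier, x ∈ U ∧ IsAffineOpen toSpace U

namespace MonoidScheme

/-- A morphism of monoid schemes: a morphism of spaces with sheaves of monoids that is local. -/
@[ext]
structure Hom (X Y : MonoidScheme.{u}) where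
  toMor : X.toSpace ⟶ Y.toSpace
  isLocal : IsLocalMorphism toMor

instance : Category MonoidScheme.{u} where
  Hom := Hom
  id X := ⟨𝟙 X.toSpace, fun _ _ _ _ h => h⟩
  comp f g := ⟨f.toMor ≫ g.toMor, fun x V s hx h =>
    g.isLocal (f.toMor.hom.base x) V s hx (f.isLocal x _ _ hx h)⟩

/-- A closed immersion: every point of the target has an affine open neighbourhood `U` whose
preimage is affine (or empty) and for which `𝒪_Y(U) → 𝒪_X(f⁻¹U)` is surjective; locally on the
target it is `Spec N → Spec M` for a surjective homomorphism `M → N`.  (For monoid schemes the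
image need not be a closed subset.) -/
def IsClosedImmersion {X Y : MonoidScheme.{u}} (f : X ⟶ Y) : Prop :=
  ∀ y : Y.toSpace.carrier, ∃ U : Opens Y.toSpace.carrier, y ∈ U ∧ IsAffineOpen Y.toSpace U ∧
    ((Opens.map f.toMor.hom.base).obj U = ⊥ ∨
      IsAffineOpen X.toSpace ((Opens.map f.toMor.hom.base).obj U)) ∧
    Function.Surjective (f.toMor.hom.c.app (op U))

/-- `X` is separated: the diagonal morphism from `X` to the product `X × X` (any product of `X`
with itself in the category of monoid schemes) is a closed immersion. -/
def IsSeparated (X : MonoidScheme.{u}) : Prop :=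
  ∀ (P : MonoidScheme.{u}) (p q : P ⟶ X), Nonempty (Limits.IsLimit (Limits.BinaryFan.mk p q)) →
    ∀ d : X ⟶ P, d ≫ p = 𝟙 X → d ≫ q = 𝟙 X → IsClosedImmersion d

end MonoidScheme

/-- An `𝒪_X`-set: a sheaf of sets on `X` with an action of the sheaf of monoids `𝒪_X`. -/
structure OSet (X : MonoidedSpace.{u}) where
  presheaf : TopCat.Presheaf (Type u) X.carrier
  isSheaf : presheaf.IsSheaf
  [mulAction : ∀ U : (Opens X.carrier)ᵒᵖ, MulAction (X.presheaf.obj U) (presheaf.obj U)]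
  map_smul : ∀ {U V : (Opens X.carrier)ᵒᵖ} (i : U ⟶ V) (a : X.presheaf.obj U)
    (s : presheaf.obj U),
    presheaf.map i (a • s) = (X.presheaf.map i a : X.presheaf.obj V) • presheaf.map i s

namespace OSet

attribute [instance] OSet.mulAction

variable {X : MonoidedSpace.{u}}

/-- A morphism of `𝒪_X`-sets: an equivariant morphism of sheaves of sets. -/
@[ext]
structure Hom (V W : OSet X) where
  val : V.presheaf ⟶ W.presheaf
  map_smul : ∀ (U : (Opens X.carrier)ᵒᵖ) (a : X.presheaf.obj U) (s : V.presheaf.obj U),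
    val.app U (a • s) = a • val.app U s

instance : Category (OSet X) where
  Hom := Hom
  id V := ⟨𝟙 V.presheaf, fun _ _ _ => rfl⟩
  comp f g := ⟨f.val ≫ g.val, fun U a s => by
    simp [f.map_smul, g.map_smul]⟩

/-- The structure sheaf `𝒪_X`, acting on itself by multiplication. -/
def structureSheaf (X : MonoidedSpace.{u}) : OSet X where
  presheaf := X.presheaf ⋙ forget CommMonCat.{u}
  isSheaf := (TopCat.Presheaf.isSheaf_iff_isSheaf_comp (forget CommMonCat.{u}) _).mp X.IsSheaf
  mulAction U := inferInstanceAs (MulAction (X.presheaf.obj U) (X.presheaf.obj U))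
  map_smul i a s := map_mul (X.presheaf.map i).hom a s

/-- The restriction of an `𝒪_X`-set to an open subspace. -/
noncomputable def onOpen (V : OSet X) (U : Opens X.carrier) : OSet (MonoidedSpace.onOpen X U) where
  presheaf := U.isOpenEmbedding.isOpenMap.functor.op ⋙ V.presheaf
  isSheaf := TopCat.Presheaf.isSheaf_of_isOpenEmbedding U.isOpenEmbedding V.isSheaf
  mulAction W := V.mulAction (U.isOpenEmbedding.isOpenMap.functor.op.obj W)
  map_smul i a s := V.map_smul (U.isOpenEmbedding.isOpenMap.functor.op.map i) a s

/-- `V` is a coproduct of the `𝒪_X`-sets `L i`, in the category of `𝒪_X`-sets. -/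
def IsCoproduct {ι : Type} (L : ι → OSet X) (V : OSet X) : Prop :=
  ∃ c : ∀ i, L i ⟶ V, Nonempty (Limits.IsColimit (Limits.Cofan.mk V c))

/-- `V` is locally isomorphic to the coproduct of `n` copies of the structure sheaf. -/
def IsVectorBundle (n : ℕ) : ObjectProperty (OSet X) := fun V =>
  ∀ x : X.carrier, ∃ U : Opens X.carrier, x ∈ U ∧
    IsCoproduct (fun _ : Fin n => structureSheaf (MonoidedSpace.onOpen X U)) (V.onOpen U)

end OSet

namespace MonoidScheme

/-- The category of vector bundles of rank `n` on `X`, a full subcategory of `𝒪_X`-sets. -/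
abbrev VectorBundle (X : MonoidScheme.{u}) (n : ℕ) :=
  (OSet.IsVectorBundle (X := X.toSpace) n).FullSubcategory

/-- Line bundles are vector bundles of rank `1`. -/
abbrev LineBundle (X : MonoidScheme.{u}) := X.VectorBundle 1

/-- The set `Vect_n(X)` of isomorphism classes of vector bundles of rank `n` on `X`. -/
abbrev Vect (X : MonoidScheme.{u}) (n : ℕ) := Quotient (isIsomorphicSetoid (X.VectorBundle n))

/-- The set `Pic(X)` of isomorphism classes of line bundles on `X`. -/
abbrev Pic (X : MonoidScheme.{u}) := X.Vect 1

/-- The isomorphism class of a vector bundle. -/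
def classOf {X : MonoidScheme.{u}} {n : ℕ} (V : X.VectorBundle n) : X.Vect n :=
  Quotient.mk _ V

/-- The orbit set of `Pic(X)ⁿ` under the group `Σ_n` permuting the factors. -/
abbrev PicOrbits (X : MonoidScheme.{u}) (n : ℕ) :=
  MulAction.orbitRel.Quotient (Equiv.Perm (Fin n))ᵈᵐᵃ (Fin n → X.Pic)

/-- The `Σ_n`-orbit of the tuple of isomorphism classes of line bundles `L 0, …, L (n - 1)`. -/
def orbitOf {X : MonoidScheme.{u}} {n : ℕ} (L : Fin n → X.LineBundle) : X.PicOrbits n :=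
  Quotient.mk _ fun i => classOf (L i)

/-- The vector bundle `V` is a coproduct of the line bundles `L 0, …, L (n - 1)`. -/
def IsCoproductOf {X : MonoidScheme.{u}} {n : ℕ} (V : X.VectorBundle n)
    (L : Fin n → X.LineBundle) : Prop :=
  OSet.IsCoproduct (fun i => (L i).obj) V.obj

end MonoidScheme

end MonoidGeom

/-! ### Generic points, and sheaves handled through their sections. -/

namespace MonoidGeom

/-! The point is that `X` has a generic point `η`, lying in every nonempty open set
(`MonoidScheme.exists_isGeneric`): affine opens have one, namely the empty prime, and connectedness
makes the local ones agree. Hence any two nonempty opens meet, and the presheaf sending a nonempty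
`U` to the disjoint union of the `L i (U)`, and `∅` to a point, is already a sheaf. So coproducts
are sectionwise disjoint unions over opens containing `η` (`OSet.isCoproduct_iff`), and being a
vector bundle means having local bases.

A basis on one neighbourhood of `η` colours every section of `V` over every nonempty open by the
index of the basis element of which it is a multiple near `η`. Restriction and scaling preserve
colours, so `V` is the disjoint union of its colour classes. Any other local basis has the same
finite size and meets every colour, hence meets each exactly once, so the classes are line bundles.
Conversely, a line bundle is locally generated by one section, so any colouring of it is constant.
In two decompositions of `V`, each summand of one therefore lies in a single summand of the other,
which gives uniqueness. The bijection on isomorphism classes is then formal. -/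

/-- A point that lies in every nonempty open set. -/
def IsGeneric {X : MonoidedSpace.{u}} (η : X.carrier) : Prop :=
  ∀ U : Opens X.carrier, η ∉ U → U = ⊥

/-- The monoid of sections of the structure sheaf. -/
abbrev MonoidedSpace.O (X : MonoidedSpace.{u}) (U : Opens X.carrier) : Type u :=
  X.presheaf.obj (op U)

/-- Restriction of sections of the structure sheaf. -/
def MonoidedSpace.res (X : MonoidedSpace.{u}) {W U : Opens X.carrier} (h : W ≤ U) :
    X.O U →* X.O W :=
  (X.presheaf.map (homOfLE h).op).hom

namespace OSet

variable {X : MonoidedSpace.{u}}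

/-- The sections of an `𝒪_X`-set. -/
abbrev sec (V : OSet X) (U : Opens X.carrier) : Type u := V.presheaf.obj (op U)

/-- Restriction of sections of an `𝒪_X`-set. -/
def res (V : OSet X) {W U : Opens X.carrier} (h : W ≤ U) (s : V.sec U) : V.sec W :=
  V.presheaf.map (homOfLE h).op s

theorem res_self (V : OSet X) {U : Opens X.carrier} (h : U ≤ U) (s : V.sec U) :
    V.res h s = s :=
  ConcreteCategory.congr_hom (V.presheaf.map_id (op U)) s

theorem res_res (V : OSet X) {U W Z : Opens X.carrier} (h : W ≤ U) (k : Z ≤ W) (s : V.sec U) :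
    V.res k (V.res h s) = V.res (k.trans h) s :=
  (ConcreteCategory.congr_hom (V.presheaf.map_comp (homOfLE h).op (homOfLE k).op) s).symm

theorem res_smul (V : OSet X) {W U : Opens X.carrier} (h : W ≤ U) (a : X.O U) (s : V.sec U) :
    V.res h (a • s) = X.res h a • V.res h s :=
  V.map_smul _ a s

theorem eq_of_res (V : OSet X) {ι : Type u} {D : Opens X.carrier} (U : ι → Opens X.carrier)
    (hU : ∀ i, U i ≤ D) (hD : D ≤ iSup U) {s t : V.sec D}
    (h : ∀ i, V.res (hU i) s = V.res (hU i) t) : s = t :=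
  TopCat.Sheaf.eq_of_locally_eq' ⟨V.presheaf, V.isSheaf⟩ U D (fun i => homOfLE (hU i)) hD s t h

theorem exists_glue (V : OSet X) {ι : Type u} {D : Opens X.carrier} (U : ι → Opens X.carrier)
    (hU : ∀ i, U i ≤ D) (hD : D ≤ iSup U) (s : ∀ i, V.sec (U i))
    (h : ∀ i j, V.res (inf_le_left : U i ⊓ U j ≤ U i) (s i) = V.res inf_le_right (s j)) :
    ∃ t : V.sec D, ∀ i, V.res (hU i) t = s i :=
  (TopCat.Sheaf.existsUnique_gluing' (CC := fun X => X) ⟨V.presheaf, V.isSheaf⟩ U D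
    (fun i => homOfLE (hU i)) hD (fun i => s i) h).exists

/-- The sheaf condition for the empty cover. With its companion on existence, it disposes of every
open set that misses `η`. -/
theorem subsingleton_sec (V : OSet X) {U : Opens X.carrier} (h : U = ⊥) :
    Subsingleton (V.sec U) :=
  ⟨fun _ _ => V.eq_of_res (ι := PEmpty) (fun i => i.elim) (fun i => i.elim) (by simp [h])
    (fun i => i.elim)⟩

theorem nonempty_sec (V : OSet X) {U : Opens X.carrier} (h : U = ⊥) : Nonempty (V.sec U) :=
  let ⟨t, _⟩ := V.exists_glue (ι := PEmpty) (D := U) (fun i => i.elim) (fun i => i.elim)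
    (by simp [h]) (fun i => i.elim) (fun i => i.elim)
  ⟨t⟩

/-- An `𝒪_X`-set given by its sections, their restriction maps and the gluing property. -/
def ofSections (S : Opens X.carrier → Type u) [∀ U, MulAction (X.O U) (S U)]
    (r : ∀ {W U : Opens X.carrier}, W ≤ U → S U → S W)
    (r_self : ∀ (U) (s : S U), r le_rfl s = s)
    (r_res : ∀ {U W Z} (h : W ≤ U) (k : Z ≤ W) (s : S U), r k (r h s) = r (k.trans h) s)
    (r_smul : ∀ {W U} (h : W ≤ U) (a : X.O U) (s : S U), r h (a • s) = X.res h a • r h s)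
    (glue : ∀ {ι : Type u} (U : ι → Opens X.carrier) (s : ∀ i, S (U i)),
      (∀ i j, r (inf_le_left : U i ⊓ U j ≤ U i) (s i) = r inf_le_right (s j)) →
        ∃! t : S (iSup U), ∀ i, r (le_iSup U i) t = s i) : OSet X where
  presheaf :=
    { obj := fun U => S U.unop
      map := fun i => TypeCat.ofHom (r (leOfHom i.unop))
      map_id := fun U => by ext s; exact r_self _ s
      map_comp := fun i j => by ext s; exact (r_res _ _ s).symm }
  isSheaf := TopCat.Presheaf.isSheaf_of_isSheafUniqueGluing_types _ fun _ U s h => glue U s h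
  mulAction U := (inferInstance : MulAction (X.O U.unop) (S U.unop))
  map_smul i a s := r_smul (leOfHom i.unop) a s

/-- The map on sections of a morphism of `𝒪_X`-sets. -/
def Hom.app {V W : OSet X} (f : V ⟶ W) (U : Opens X.carrier) (s : V.sec U) : W.sec U :=
  (Hom.val f).app (op U) s

theorem Hom.app_smul {V W : OSet X} (f : V ⟶ W) {U : Opens X.carrier} (a : X.O U) (s : V.sec U) :
    Hom.app f U (a • s) = a • Hom.app f U s :=
  Hom.map_smul f (op U) a s

theorem Hom.app_res {V W : OSet X} (f : V ⟶ W) {U Z : Opens X.carrier} (h : Z ≤ U) (s : V.sec U) :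
    Hom.app f Z (V.res h s) = W.res h (Hom.app f U s) :=
  ConcreteCategory.congr_hom ((Hom.val f).naturality (homOfLE h).op) s

theorem Hom.comp_app {V W Z : OSet X} (f : V ⟶ W) (g : W ⟶ Z) (U : Opens X.carrier)
    (s : V.sec U) : Hom.app (f ≫ g) U s = Hom.app g U (Hom.app f U s) := rfl

theorem Hom.ext_app {V W : OSet X} {f g : V ⟶ W} (h : ∀ U s, Hom.app f U s = Hom.app g U s) :
    f = g :=
  Hom.ext (by ext U s; exact h _ s)

/-- A morphism of `𝒪_X`-sets given by its maps on sections. -/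
def homMk {V W : OSet X} (f : ∀ U, V.sec U → W.sec U)
    (f_res : ∀ {U Z} (h : Z ≤ U) (s : V.sec U), f Z (V.res h s) = W.res h (f U s))
    (f_smul : ∀ (U) (a : X.O U) (s : V.sec U), f U (a • s) = a • f U s) : V ⟶ W where
  val :=
    { app := fun U => TypeCat.ofHom (f U.unop)
      naturality := fun U Z i => by ext s; exact f_res (leOfHom i.unop) s }
  map_smul U a s := f_smul U.unop a s

/-- A morphism that is bijective on all sections over open sets containing a generic point is an
isomorphism. -/
theorem nonempty_iso_of_bijective {η : X.carrier} (hη : IsGeneric η) {V W : OSet X} (f : V ⟶ W)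
    (hf : ∀ U, η ∈ U → Function.Bijective (Hom.app f U)) : Nonempty (V ≅ W) := by
  have hf' : ∀ U, Function.Bijective (Hom.app f U) := fun U => by
    by_cases h : η ∈ U
    · exact hf U h
    · have := V.subsingleton_sec (hη U h)
      have := W.subsingleton_sec (hη U h)
      obtain ⟨s⟩ := V.nonempty_sec (hη U h)
      exact ⟨fun _ _ _ => Subsingleton.elim _ _, fun _ => ⟨s, Subsingleton.elim _ _⟩⟩
  let e := fun U => Equiv.ofBijective _ (hf' U)
  have he : ∀ U s, Hom.app f U ((e U).symm s) = s := fun U s => (e U).apply_symm_apply s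
  refine ⟨⟨f, homMk (fun U => (e U).symm) (fun h s => ?_) (fun U a s => ?_),
    Hom.ext_app fun U s => (e U).symm_apply_apply s,
    Hom.ext_app fun U s => (e U).apply_symm_apply s⟩⟩
  · apply (hf' _).1
    rw [he, Hom.app_res, he]
  · apply (hf' _).1
    rw [he, Hom.app_smul, he]

theorem _root_.Sigma.exists_eq_mk {α : Type*} {β : α → Type*} {p : Σ a, β a} {a : α}
    (h : p.1 = a) : ∃ b, p = ⟨a, b⟩ := by
  subst h
  exact ⟨p.2, rfl⟩

/-! ### Coproducts as sectionwise disjoint unions. -/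

section Coproduct

variable {ι : Type} (L : ι → OSet X) (η : X.carrier)

/-- The sections of the coproduct of the `L i` when `η` is generic. -/
abbrev CoprodSec (U : Opens X.carrier) : Type u := η ∈ U → Σ i, (L i).sec U

instance (U : Opens X.carrier) : MulAction (X.O U) (CoprodSec L η U) where
  smul a s h := ⟨(s h).1, a • (s h).2⟩
  one_smul _ := funext fun _ => Sigma.ext rfl (heq_of_eq (one_smul _ _))
  mul_smul a b _ := funext fun _ => Sigma.ext rfl (heq_of_eq (mul_smul a b _))

/-- The coproduct of a family of `𝒪_X`-sets on a space with a generic point. -/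
def coprod (hη : IsGeneric η) : OSet X :=
  ofSections (CoprodSec L η) (fun h s k => (s (h k)).map id fun i => (L i).res h)
    (fun _ _ => funext fun _ => Sigma.ext rfl (heq_of_eq (res_self _ _ _)))
    (fun _ _ _ => funext fun _ => Sigma.ext rfl (heq_of_eq (res_res _ _ _ _)))
    (fun _ _ _ => funext fun _ => Sigma.ext rfl (heq_of_eq (res_smul _ _ _ _)))
    (by
      intro κ U s hs
      by_cases hU : η ∈ iSup U
      · obtain ⟨i₁, h₁⟩ := Opens.mem_iSup.mp hU
        obtain ⟨j₁, hj⟩ : ∃ j, (s i₁ h₁).1 = j := ⟨_, rfl⟩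
        -- Two members of the cover containing `η` overlap in an open set containing `η`, so their
        -- sections have the same index `j₁`. A member missing `η` is empty and receives the only
        -- section of `L j₁` there. Gluing then takes place in `L j₁` alone.
        have key : ∀ i, ∃ t : (L j₁).sec (U i), ∀ h, s i h = ⟨_, t⟩ := by
          intro i
          by_cases hi : η ∈ U i
          · have e : (s i hi).1 = j₁ :=
              (congrArg Sigma.fst (congrFun (hs i i₁) ⟨hi, h₁⟩)).trans hj
            obtain ⟨t, ht⟩ := Sigma.exists_eq_mk e
            exact ⟨t, fun _ => ht⟩
          · exact ⟨(nonempty_sec _ (hη _ hi)).some, fun h => absurd h hi⟩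
        choose t ht using key
        obtain ⟨t', ht'⟩ := (L j₁).exists_glue U (le_iSup U) le_rfl t (by
          intro i j
          by_cases hij : η ∈ U i ⊓ U j
          · have e := congrFun (hs i j) hij
            rw [ht, ht] at e
            exact eq_of_heq (Sigma.mk.inj_iff.mp e).2
          · have := (L j₁).subsingleton_sec (hη _ hij)
            exact Subsingleton.elim _ _)
        refine ⟨fun _ => ⟨_, t'⟩, fun i => funext fun hi => ?_, fun t'' h'' => funext fun h => ?_⟩
        · rw [ht i hi]
          exact congrArg (Sigma.mk _) (ht' i)
        · have e : (t'' h).1 = j₁ := (congrArg Sigma.fst (congrFun (h'' i₁) h₁)).trans hj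
          obtain ⟨p, hp⟩ := Sigma.exists_eq_mk e
          have h3 := fun i hi => (congrFun (h'' i) hi).trans (ht i hi)
          simp only [hp] at h3
          refine hp.trans (Sigma.ext rfl (heq_of_eq ?_))
          refine eq_of_res _ U (le_iSup U) le_rfl fun i => ?_
          by_cases hi : η ∈ U i
          · rw [ht']
            exact eq_of_heq (Sigma.mk.inj_iff.mp (h3 i hi)).2
          · have := (L j₁).subsingleton_sec (hη _ hi)
            exact Subsingleton.elim _ _
      · exact ⟨fun h => absurd h hU, fun i => funext fun hi => absurd (le_iSup U i hi) hU,
          fun _ _ => funext fun h => absurd h hU⟩)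

/-- The inclusions into the coproduct. -/
def coprodι (hη : IsGeneric η) (i : ι) : L i ⟶ coprod L η hη :=
  homMk (W := coprod L η hη) (fun U s => (fun _ => ⟨i, s⟩ : CoprodSec L η U)) (fun _ _ => rfl) (fun _ _ _ => rfl)

end Coproduct

/-- The maps `c i` identify the sections of `V` over the open sets containing `η` with the disjoint
union of the sections of the `L i`. -/
def IsDisjointUnion (η : X.carrier) {ι : Type} {L : ι → OSet X} {V : OSet X}
    (c : ∀ i, L i ⟶ V) : Prop :=
  ∀ U, η ∈ U → Function.Bijective fun p : Σ i, (L i).sec U => Hom.app (c p.1) U p.2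

theorem isDisjointUnion_coprodι {η : X.carrier} (hη : IsGeneric η) {ι : Type} (L : ι → OSet X) :
    IsDisjointUnion η (coprodι L η hη) := fun _ h =>
  ⟨fun _ _ e => congrFun e h, fun s => ⟨(s : CoprodSec L η _) h, rfl⟩⟩

open Limits in
/-- A disjoint union is a coproduct. -/
theorem IsDisjointUnion.nonempty_isColimit {η : X.carrier} (hη : IsGeneric η) {ι : Type}
    {L : ι → OSet X} {V : OSet X} {c : ∀ i, L i ⟶ V} (hc : IsDisjointUnion η c) :
    Nonempty (IsColimit (Cofan.mk V c)) := by
  let e := fun U h => Equiv.ofBijective _ (hc U h)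
  have he : ∀ U h i s, (e U h).symm (Hom.app (c i) U s) = ⟨i, s⟩ := fun U h i s =>
    (e U h).symm_apply_apply ⟨i, s⟩
  have hind : ∀ U, η ∈ U → ∀ s : V.sec U, ∃ i t, Hom.app (c i) U t = s := fun U h s => by
    obtain ⟨⟨i, t⟩, h⟩ := (hc U h).2 s
    exact ⟨i, t, h⟩
  classical
  -- The map induced by the `f i`: apply `f i` on the summand containing `s`. If `η ∉ U`, the target
  -- has only one section.
  let g : ∀ (W : OSet X) (f : ∀ i, L i ⟶ W) (U) (s : V.sec U), W.sec U := fun W f U s =>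
    if h : η ∈ U then Hom.app (f ((e U h).symm s).1) U ((e U h).symm s).2
    else (W.nonempty_sec (hη U h)).some
  have hg : ∀ W f U i s, g W f U (Hom.app (c i) U s) = Hom.app (f i) U s := fun W f U i s => by
    by_cases h : η ∈ U
    · simp only [g, h, dite_true]
      rw [he _ h]
    · have := W.subsingleton_sec (hη U h)
      exact Subsingleton.elim _ _
  refine ⟨Cofan.IsColimit.mk _ (fun t => homMk (g t.pt t.inj) ?_ ?_) ?_ ?_⟩
  · intro U Z h s
    by_cases hZ : η ∈ Z
    · obtain ⟨i, s, rfl⟩ := hind U (h hZ) s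
      rw [hg, ← Hom.app_res, hg, Hom.app_res]
    · have := t.pt.subsingleton_sec (hη Z hZ)
      exact Subsingleton.elim _ _
  · intro U a s
    by_cases hZ : η ∈ U
    · obtain ⟨i, s, rfl⟩ := hind U hZ s
      rw [hg, ← Hom.app_smul, hg, Hom.app_smul]
    · have := t.pt.subsingleton_sec (hη U hZ)
      exact Subsingleton.elim _ _
  · intro t i
    exact Hom.ext_app fun U s => hg _ _ _ _ _
  · intro t m hm
    refine Hom.ext_app fun U s => ?_
    by_cases hZ : η ∈ U
    · obtain ⟨i, s, rfl⟩ := hind U hZ s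
      refine Eq.trans ?_ (hg _ _ _ _ _).symm
      rw [← hm i]
      rfl
    · have := t.pt.subsingleton_sec (hη U hZ)
      exact Subsingleton.elim _ _

open Limits in
/-- A coproduct is a disjoint union. -/
theorem IsDisjointUnion.of_isColimit {η : X.carrier} (hη : IsGeneric η) {ι : Type}
    {L : ι → OSet X} {V : OSet X} {c : ∀ i, L i ⟶ V} (hc : IsColimit (Cofan.mk V c)) :
    IsDisjointUnion η c := by
  intro U hU
  -- The explicit model is also a colimit, so bijectivity transfers along the canonical isomorphism.
  obtain ⟨hC⟩ := (isDisjointUnion_coprodι hη L).nonempty_isColimit hη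
  let e := hc.coconePointUniqueUpToIso hC
  have h1 : ∀ i s, Hom.app e.hom U (Hom.app (c i) U s) = Hom.app (coprodι L η hη i) U s := by
    intro i s
    rw [← Hom.comp_app]
    congr 1
    exact hc.comp_coconePointUniqueUpToIso_hom hC ⟨i⟩
  have hinj : Function.Injective (Hom.app e.hom U) :=
    Function.LeftInverse.injective (g := Hom.app e.inv U) fun s => by
      rw [← Hom.comp_app, e.hom_inv_id]
      rfl
  have hb := isDisjointUnion_coprodι hη L U hU
  constructor
  · intro p q h
    apply hb.1
    change Hom.app (coprodι L η hη _) U _ = Hom.app (coprodι L η hη _) U _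
    rw [← h1, ← h1]
    exact congrArg _ h
  · intro s
    obtain ⟨p, hp⟩ := hb.2 (Hom.app e.hom U s)
    refine ⟨p, hinj ?_⟩
    rw [← hp]
    exact h1 _ _

/-- Trades the universal property for a condition on sections. It is applied to `X` and also to its
open subspaces. -/
theorem isCoproduct_iff {η : X.carrier} (hη : IsGeneric η) {ι : Type}
    {L : ι → OSet X} {V : OSet X} :
    IsCoproduct L V ↔ ∃ c : ∀ i, L i ⟶ V, IsDisjointUnion η c :=
  ⟨fun ⟨c, ⟨hc⟩⟩ => ⟨c, .of_isColimit hη hc⟩, fun ⟨c, hc⟩ => ⟨c, hc.nonempty_isColimit hη⟩⟩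

end OSet

end MonoidGeom

/-! ### Vector bundles in terms of local bases. -/

namespace MonoidGeom

theorem IsGeneric.mem {X : MonoidedSpace.{u}} {η x : X.carrier} (hη : IsGeneric η)
    {U : Opens X.carrier} (hx : x ∈ U) : η ∈ U := by
  by_contra h
  rw [hη U h] at hx
  exact hx

/-- The open set of `X` underlying an open set of the open subspace `U`. -/
abbrev MonoidedSpace.ofOpen {X : MonoidedSpace.{u}} {U : Opens X.carrier}
    (W : Opens (MonoidedSpace.onOpen X U).carrier) : Opens X.carrier :=
  U.isOpenEmbedding.isOpenMap.functor.obj W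

theorem MonoidedSpace.ofOpen_le {X : MonoidedSpace.{u}} {U : Opens X.carrier}
    (W : Opens (MonoidedSpace.onOpen X U).carrier) : MonoidedSpace.ofOpen W ≤ U := by
  rintro _ ⟨y, _, rfl⟩
  exact y.2

theorem MonoidedSpace.exists_ofOpen_eq {X : MonoidedSpace.{u}} {U W : Opens X.carrier}
    (h : W ≤ U) : ∃ W' : Opens (MonoidedSpace.onOpen X U).carrier, ofOpen W' = W :=
  ⟨(Opens.map U.inclusion').obj W, Opens.ext <| by
    ext x
    exact ⟨fun ⟨_, hy, e⟩ => e ▸ hy, fun hx => ⟨⟨x, h hx⟩, hx, rfl⟩⟩⟩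

theorem MonoidedSpace.mem_ofOpen {X : MonoidedSpace.{u}} {U : Opens X.carrier} {x : X.carrier}
    (hx : x ∈ U) (W : Opens (MonoidedSpace.onOpen X U).carrier) :
    x ∈ ofOpen W ↔ (⟨x, hx⟩ : U) ∈ W :=
  ⟨fun ⟨_, hy, e⟩ => by subst e; exact hy, fun h => ⟨_, h, rfl⟩⟩

theorem IsGeneric.onOpen {X : MonoidedSpace.{u}} {η : X.carrier} (hη : IsGeneric η)
    {U : Opens X.carrier} (hU : η ∈ U) :
    IsGeneric (X := MonoidedSpace.onOpen X U) (⟨η, hU⟩ : U) := by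
  intro W hW
  refine Opens.ext (Set.eq_empty_of_forall_notMem fun y hy => hW ?_)
  refine (MonoidedSpace.mem_ofOpen hU W).mp ?_
  exact hη.mem ((MonoidedSpace.mem_ofOpen y.2 W).mpr hy)

namespace OSet

variable {X : MonoidedSpace.{u}}

/-- The sections `e j` over `U` form a basis: over every smaller open set containing `η`, each
section is `a • e j` for a unique `j` and a unique `a`. -/
def IsBasis (η : X.carrier) {V : OSet X} {U : Opens X.carrier} {ι : Type} (e : ι → V.sec U) :
    Prop :=
  ∀ W (h : W ≤ U), η ∈ W → Function.Bijective fun p : ι × X.O W => p.2 • V.res h (e p.1)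

/-- The multiples of the restriction of a section. -/
def smulRes (V : OSet X) {U W : Opens X.carrier} (s : V.sec U) (h : W ≤ U) (a : X.O W) : V.sec W :=
  a • V.res h s

theorem res_smulRes (V : OSet X) {U W Z : Opens X.carrier} (s : V.sec U) (h : W ≤ U) (k : Z ≤ W)
    (a : X.O W) : V.res k (V.smulRes s h a) = V.smulRes s (k.trans h) (X.res k a) :=
  (V.res_smul _ _ _).trans (congrArg _ (V.res_res _ _ _))

theorem smulRes_mul (V : OSet X) {U W : Opens X.carrier} (s : V.sec U) (h : W ≤ U) (a b : X.O W) :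
    V.smulRes s h (a * b) = a • V.smulRes s h b :=
  mul_smul _ _ _

/-- The morphism from the structure sheaf of an open subspace given by a section. -/
noncomputable def homOfSection (V : OSet X) {U : Opens X.carrier} (s : V.sec U) :
    structureSheaf (MonoidedSpace.onOpen X U) ⟶ V.onOpen U :=
  homMk (fun W => V.smulRes s (MonoidedSpace.ofOpen_le W))
    (fun h a => (V.res_smulRes s (MonoidedSpace.ofOpen_le _)
      (U.isOpenEmbedding.isOpenMap.functor.map (homOfLE h)).le a).symm)
    (fun W a b => V.smulRes_mul s (MonoidedSpace.ofOpen_le W) a b)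

/-- A morphism from the structure sheaf is determined by the image of `1`, so a family of maps into
`V` restricted to `U` is a family of sections over `U`. -/
theorem isCoproduct_onOpen_iff {η : X.carrier} (hη : IsGeneric η) {V : OSet X}
    {U : Opens X.carrier} (hU : η ∈ U) {ι : Type} :
    IsCoproduct (fun _ : ι => structureSheaf (MonoidedSpace.onOpen X U)) (V.onOpen U) ↔
      ∃ e : ι → V.sec U, IsBasis η e := by
  rw [isCoproduct_iff (hη.onOpen hU)]
  constructor
  · rintro ⟨c, hc⟩
    -- The image of `⊤` is `U` only up to a proof, so sections are moved by restriction.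
    have hT : U ≤ MonoidedSpace.ofOpen (⊤ : Opens (MonoidedSpace.onOpen X U).carrier) :=
      fun x hx => ⟨⟨x, hx⟩, trivial, rfl⟩
    let e : ι → V.sec (MonoidedSpace.ofOpen (⊤ : Opens (MonoidedSpace.onOpen X U).carrier)) :=
      fun j => Hom.app (c j) ⊤
        (1 : X.O (MonoidedSpace.ofOpen (⊤ : Opens (MonoidedSpace.onOpen X U).carrier)))
    refine ⟨fun j => V.res hT (e j), fun W h hW => ?_⟩
    obtain ⟨W, rfl⟩ := MonoidedSpace.exists_ofOpen_eq h
    have key : ∀ j (a : X.O (MonoidedSpace.ofOpen W)),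
        a • V.res h (V.res hT (e j)) = Hom.app (c j) W a := by
      intro j a
      have h1 : Hom.app (c j) W (1 : X.O (MonoidedSpace.ofOpen W)) = V.res (h.trans hT) (e j) := by
        refine Eq.trans ?_ (Hom.app_res (c j) (le_top : W ≤ ⊤)
          (1 : X.O (MonoidedSpace.ofOpen (⊤ : Opens (MonoidedSpace.onOpen X U).carrier))))
        exact congrArg _ (map_one (X.res (h.trans hT))).symm
      rw [V.res_res, ← h1]
      refine (Hom.app_smul (c j) (U := W) a (1 : X.O (MonoidedSpace.ofOpen W))).symm.trans ?_
      exact congrArg _ (mul_one a)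
    have := hc W ((MonoidedSpace.mem_ofOpen hU W).mp hW)
    simp_rw [key]
    exact this.comp (Equiv.sigmaEquivProd ι (X.O (MonoidedSpace.ofOpen W))).symm.bijective
  · rintro ⟨e, he⟩
    refine ⟨fun j => V.homOfSection (e j), fun W hW => ?_⟩
    exact (he (MonoidedSpace.ofOpen W) (MonoidedSpace.ofOpen_le W)
      ((MonoidedSpace.mem_ofOpen hU W).mpr hW)).comp
      (Equiv.sigmaEquivProd ι (X.O (MonoidedSpace.ofOpen W))).bijective

theorem isVectorBundle_iff {η : X.carrier} (hη : IsGeneric η) {V : OSet X} {n : ℕ} :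
    IsVectorBundle n V ↔
      ∀ x, ∃ U : Opens X.carrier, x ∈ U ∧ ∃ e : Fin n → V.sec U, IsBasis η e :=
  forall_congr' fun _ => exists_congr fun _ => and_congr_right fun hx =>
    isCoproduct_onOpen_iff hη (hη.mem hx)

theorem IsBasis.res {η : X.carrier} {V : OSet X} {U : Opens X.carrier} {ι : Type}
    {e : ι → V.sec U} (he : IsBasis η e) {W : Opens X.carrier} (h : W ≤ U) :
    IsBasis η fun j => V.res h (e j) := by
  intro Z k hZ
  simp_rw [V.res_res]
  exact he Z _ hZ

/-- Bases of the summands combine to a basis of a disjoint union. -/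
theorem IsDisjointUnion.isBasis {η : X.carrier} {ι : Type} {L : ι → OSet X} {V : OSet X}
    {c : ∀ i, L i ⟶ V} (hc : IsDisjointUnion η c) {U : Opens X.carrier}
    {b : ∀ i, Fin 1 → (L i).sec U} (hb : ∀ i, IsBasis η (b i)) :
    IsBasis η fun i => Hom.app (c i) U (b i 0) := by
  intro W h hW
  have : ∀ i, Function.Bijective fun a : X.O W => a • (L i).res h (b i 0) := fun i =>
    (hb i W h hW).comp (Equiv.uniqueProd (X.O W) (Fin 1)).symm.bijective
  have := (hc W hW).comp
    ((Equiv.sigmaCongrRight fun i => Equiv.ofBijective _ (this i)).bijective.comp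
      (Equiv.sigmaEquivProd ι (X.O W)).symm.bijective)
  convert! this using 2 with p
  exact ((Hom.app_smul _ _ _).trans (congrArg _ (Hom.app_res _ _ _))).symm

/-- The finitely many trivialising neighbourhoods of a point can be intersected. -/
theorem IsDisjointUnion.isVectorBundle {η : X.carrier} (hη : IsGeneric η) {n : ℕ}
    {L : Fin n → OSet X} {V : OSet X} {c : ∀ i, L i ⟶ V} (hc : IsDisjointUnion η c)
    (hL : ∀ i, IsVectorBundle 1 (L i)) : IsVectorBundle n V := by
  simp only [isVectorBundle_iff hη] at hL ⊢
  intro x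
  choose U hU b hb using fun i => hL i x
  refine ⟨⟨⋂ i, U i, isOpen_iInter_of_finite fun i => (U i).2⟩, Set.mem_iInter.mpr hU, _,
    hc.isBasis fun i => (hb i).res fun y hy => Set.mem_iInter.mp hy i⟩

/-! ### Colourings and their colour classes. -/

/-- A colouring of the sections of an `𝒪_X`-set over the open sets containing `η`. -/
structure Coloring (V : OSet X) (η : X.carrier) (ι : Type) where
  color : ∀ U, η ∈ U → V.sec U → ι
  color_res : ∀ {U W} (h : W ≤ U) (hW : η ∈ W) (s : V.sec U),
    color W hW (V.res h s) = color U (h hW) s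
  color_smul : ∀ {U} (hU : η ∈ U) (a : X.O U) (s : V.sec U), color U hU (a • s) = color U hU s

namespace Coloring

variable {V : OSet X} {η : X.carrier} {ι : Type}

/-- The colouring of a disjoint union by the index of the summand. -/
theorem exists_of_isDisjointUnion {L : ι → OSet X} {c : ∀ i, L i ⟶ V}
    (hc : IsDisjointUnion η c) :
    ∃ χ : Coloring V η ι, ∀ U hU i s, χ.color U hU (Hom.app (c i) U s) = i := by
  let e := fun U hU => Equiv.ofBijective _ (hc U hU)
  have he : ∀ U hU i s, (e U hU).symm (Hom.app (c i) U s) = ⟨i, s⟩ := fun U h i s =>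
    (e U h).symm_apply_apply ⟨i, s⟩
  refine ⟨⟨fun U hU s => ((e U hU).symm s).1, fun {U W} h hW s => ?_, fun {U} hU a s => ?_⟩,
    fun U hU i s => congrArg Sigma.fst (he U hU i s)⟩
  · obtain ⟨⟨i, s⟩, rfl⟩ := (hc U (h hW)).2 s
    dsimp only
    rw [← Hom.app_res, he _ hW, he _ (h hW)]
  · obtain ⟨⟨i, s⟩, rfl⟩ := (hc U hU).2 s
    dsimp only
    rw [← Hom.app_smul, he _ hU, he _ hU]

/-- The colouring defined by a basis near `η`. -/
theorem exists_of_isBasis {U : Opens X.carrier} (hU : η ∈ U) {e : ι → V.sec U}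
    (he : IsBasis η e) : ∃ χ : Coloring V η ι, ∀ i, χ.color U hU (e i) = i := by
  -- Since `W ⊓ U` still contains `η`, a section over `W` restricts there to a unique `a • e i`; its
  -- colour is this `i`.
  let f := fun W (hW : η ∈ W) => Equiv.ofBijective _
    (he (W ⊓ U) (inf_le_right : W ⊓ U ≤ U) ⟨hW, hU⟩)
  have hf : ∀ W hW i a, (f W hW).symm (a • V.res inf_le_right (e i)) = ⟨i, a⟩ :=
    fun W hW i a => (f W hW).symm_apply_apply ⟨i, a⟩
  have hs : ∀ W, η ∈ W → ∀ s : V.sec W, ∃ i a,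
      V.res inf_le_left s = a • V.res (inf_le_right : W ⊓ U ≤ U) (e i) := fun W hW s => by
    obtain ⟨⟨i, a⟩, h⟩ := (f W hW).surjective (V.res inf_le_left s)
    exact ⟨i, a, h.symm⟩
  refine ⟨⟨fun W hW s => ((f W hW).symm (V.res inf_le_left s)).1, fun {W Z} h hZ s => ?_,
    fun {W} hW a s => ?_⟩, fun i => ?_⟩
  · obtain ⟨i, a, hi⟩ := hs W (h hZ) s
    have : V.res inf_le_left (V.res h s) =
        X.res (inf_le_inf_right U h) a • V.res (inf_le_right : Z ⊓ U ≤ U) (e i) := by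
      rw [V.res_res, ← V.res_res (inf_le_right : W ⊓ U ≤ U) (inf_le_inf_right U h),
        ← V.res_smul, ← hi, V.res_res]
    rw [this, hi, hf Z hZ, hf W (h hZ)]
  · obtain ⟨i, b, hi⟩ := hs W hW s
    rw [V.res_smul, hi, smul_smul, hf W hW, hf W hW]
  · dsimp only
    rw [← one_smul (X.O (U ⊓ U)) (V.res inf_le_left (e i)), hf U hU]

variable (χ : Coloring V η ι)

/-- The sections of colour `i`. -/
def ColorClassSec (i : ι) (U : Opens X.carrier) : Type u :=
  {s : V.sec U // ∀ hU, χ.color U hU s = i}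

instance (i : ι) (U : Opens X.carrier) : MulAction (X.O U) (χ.ColorClassSec i U) where
  smul a s := ⟨a • s.1, fun hU => (χ.color_smul hU a s.1).trans (s.2 hU)⟩
  one_smul _ := Subtype.ext (one_smul _ _)
  mul_smul a b _ := Subtype.ext (mul_smul a b _)

/-- The sub-`𝒪_X`-set of sections of colour `i`. -/
def colorClass (i : ι) : OSet X :=
  ofSections (χ.ColorClassSec i)
    (fun h s => ⟨V.res h s.1, fun hU => (χ.color_res h hU s.1).trans (s.2 (h hU))⟩)
    (fun _ _ => Subtype.ext (res_self _ _ _))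
    (fun _ _ _ => Subtype.ext (res_res _ _ _ _))
    (fun _ _ _ => Subtype.ext (res_smul _ _ _ _))
    (by
      intro κ U s hs
      obtain ⟨t, ht⟩ := V.exists_glue U (le_iSup U) le_rfl (fun k => (s k).1)
        fun j k => congrArg Subtype.val (hs j k)
      refine ⟨⟨t, fun hU => ?_⟩, fun k => Subtype.ext (ht k), fun t' ht' =>
        Subtype.ext (V.eq_of_res U (le_iSup U) le_rfl fun k => ?_)⟩
      -- The colour of the glued section can be read off on any member of the cover containing `η`.
      · obtain ⟨k, hk⟩ := Opens.mem_iSup.mp hU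
        rw [← χ.color_res (le_iSup U k) hk t, ht]
        exact (s k).2 hk
      · exact (congrArg Subtype.val (ht' k)).trans (ht k).symm)

/-- The inclusion of the sections of colour `i`. -/
def colorClassι (i : ι) : χ.colorClass i ⟶ V :=
  homMk (V := χ.colorClass i) (fun _ s => s.1) (fun _ _ => rfl) (fun _ _ _ => rfl)

theorem isDisjointUnion_colorClassι :
    IsDisjointUnion η (χ.colorClassι) := by
  intro U hU
  constructor
  · rintro ⟨i, s, hs⟩ ⟨j, t, ht⟩ h
    obtain rfl : s = t := h
    obtain rfl : i = j := (hs hU).symm.trans (ht hU)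
    rfl
  · exact fun s => ⟨⟨χ.color U hU s, s, fun _ => rfl⟩, rfl⟩

/-- A summand of a disjoint union is isomorphic to the sections of its colour. -/
theorem nonempty_iso_colorClass (hη : IsGeneric η) {κ : Type} {L : κ → OSet X} {c : ∀ k, L k ⟶ V}
    (hc : IsDisjointUnion η c) {π : κ → ι} (hπ : Function.Injective π)
    (h : ∀ U hU k s, χ.color U hU (Hom.app (c k) U s) = π k) (k : κ) :
    Nonempty (L k ≅ χ.colorClass (π k)) := by
  refine nonempty_iso_of_bijective hη
    (homMk (W := χ.colorClass (π k)) (fun U s => ⟨Hom.app (c k) U s, fun hU => h U hU k s⟩)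
      (fun h s => Subtype.ext (Hom.app_res _ _ _)) (fun _ a s => Subtype.ext (Hom.app_smul _ _ _)))
    fun U hU => ⟨fun s t e => ?_, ?_⟩
  · have := (hc U hU).1 (a₁ := ⟨k, s⟩) (a₂ := ⟨k, t⟩) (congrArg Subtype.val e)
    exact eq_of_heq (Sigma.mk.inj_iff.mp this).2
  · rintro ⟨s, hs⟩
    obtain ⟨⟨k', t⟩, rfl⟩ := (hc U hU).2 s
    obtain rfl : k' = k := hπ ((h U hU k' t).symm.trans (hs hU))
    exact ⟨t, rfl⟩

/-- A basis with exactly one element of colour `i` gives a basis of the sections of colour `i`. -/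
theorem isBasis_colorClass {κ : Type} {U : Opens X.carrier} (hU : η ∈ U)
    {e : κ → V.sec U} (he : IsBasis η e) {k : κ} {i : ι}
    (hk : ∀ k', χ.color U hU (e k') = i ↔ k' = k) :
    IsBasis η (V := χ.colorClass i) (fun _ : Fin 1 => ⟨e k, fun _ => (hk k).mpr rfl⟩) := by
  intro W h hW
  constructor
  · rintro ⟨p, a⟩ ⟨q, b⟩ e'
    have := (he W h hW).1 (a₁ := ⟨k, a⟩) (a₂ := ⟨k, b⟩) (congrArg Subtype.val e')
    exact Prod.ext (Subsingleton.elim _ _) (Prod.ext_iff.mp this).2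
  · rintro ⟨s, hs⟩
    obtain ⟨⟨k', a⟩, rfl⟩ := (he W h hW).2 s
    have h1 := hs hW
    dsimp only at h1
    rw [χ.color_smul, χ.color_res, hk] at h1
    subst h1
    exact ⟨⟨0, a⟩, rfl⟩

/-- On a line bundle, every colouring is constant. -/
theorem exists_color_eq (hη : IsGeneric η) (hV : IsVectorBundle 1 V) :
    ∃ i, ∀ U hU s, χ.color U hU s = i := by
  -- Near `η` every section is a multiple of the single generator `e 0`, whose colour it shares.
  obtain ⟨U, hU, e, he⟩ := (isVectorBundle_iff hη).mp hV η
  refine ⟨χ.color U hU (e 0), fun W hW s => ?_⟩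
  have hWU : η ∈ W ⊓ U := ⟨hW, hU⟩
  obtain ⟨⟨j, a⟩, h⟩ := (he (W ⊓ U) inf_le_right hWU).2 (V.res inf_le_left s)
  obtain rfl : j = 0 := Subsingleton.elim _ _
  rw [← χ.color_res (inf_le_left : W ⊓ U ≤ W) hWU, ← h]
  dsimp only
  rw [χ.color_smul, χ.color_res]

/-- The pullback of a colouring along a morphism. -/
def comap {L : OSet X} (f : L ⟶ V) : Coloring L η ι where
  color U hU s := χ.color U hU (Hom.app f U s)
  color_res h hW s := by rw [Hom.app_res, χ.color_res]
  color_smul hU a s := by rw [Hom.app_smul, χ.color_smul]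

end Coloring

/-! ### Existence and uniqueness of the decomposition. -/

/-- A vector bundle of rank `n` is a disjoint union of `n` line bundles. -/
theorem IsVectorBundle.exists_isDisjointUnion {η : X.carrier} (hη : IsGeneric η) {n : ℕ}
    {V : OSet X} (hV : IsVectorBundle n V) :
    ∃ (L : Fin n → OSet X) (c : ∀ i, L i ⟶ V), (∀ i, IsVectorBundle 1 (L i)) ∧
      IsDisjointUnion η c := by
  rw [isVectorBundle_iff hη] at hV
  obtain ⟨U, hU, e, he⟩ := hV η
  obtain ⟨χ, hχ⟩ := Coloring.exists_of_isBasis hU he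
  refine ⟨χ.colorClass, χ.colorClassι, fun i => (isVectorBundle_iff hη).mpr fun x => ?_,
    χ.isDisjointUnion_colorClassι⟩
  obtain ⟨W, hx, b, hb⟩ := hV x
  have hW := hη.mem hx
  -- On `U ⊓ W` the element `e j`, of colour `j`, is a multiple of some `b k`, which then has colour
  -- `j`. A surjection of `Fin n` to itself is injective, so each colour occurs exactly once in `b`.
  have hsurj : Function.Surjective fun k => χ.color W hW (b k) := by
    intro j
    have hUW : η ∈ U ⊓ W := ⟨hU, hW⟩
    obtain ⟨⟨k, a⟩, h⟩ := (hb (U ⊓ W) inf_le_right hUW).2 (V.res inf_le_left (e j))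
    refine ⟨k, ?_⟩
    have h1 := congrArg (χ.color (U ⊓ W) hUW) h
    dsimp only at h1
    rwa [χ.color_smul, χ.color_res, χ.color_res, hχ] at h1
  have hinj := Finite.injective_iff_surjective.mpr hsurj
  obtain ⟨k, rfl⟩ := hsurj i
  exact ⟨W, hx, _, χ.isBasis_colorClass hW hb fun k' => hinj.eq_iff⟩

/-- The line bundles in a decomposition are unique up to permutation. -/
theorem IsDisjointUnion.exists_perm {η : X.carrier} (hη : IsGeneric η) {ι : Type} [Finite ι]
    {V : OSet X} {L L' : ι → OSet X} {c : ∀ i, L i ⟶ V} {c' : ∀ i, L' i ⟶ V}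
    (hc : IsDisjointUnion η c) (hc' : IsDisjointUnion η c')
    (hL : ∀ i, IsVectorBundle 1 (L i)) (hL' : ∀ i, IsVectorBundle 1 (L' i)) :
    ∃ σ : Equiv.Perm ι, ∀ i, Nonempty (L' i ≅ L (σ i)) := by
  obtain ⟨χ, hχ⟩ := Coloring.exists_of_isDisjointUnion hc'
  -- `V` is coloured by the index of the summand `L' k`; `L i` lies entirely in colour `π i`.
  choose π hπ using fun i => (χ.comap (c i)).exists_color_eq hη (hL i)
  have hsurj : Function.Surjective π := by
    intro k
    obtain ⟨U, hU, e, -⟩ := (isVectorBundle_iff hη).mp (hL' k) η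
    obtain ⟨⟨i, t⟩, h⟩ := (hc U hU).2 (Hom.app (c' k) U (e 0))
    refine ⟨i, ?_⟩
    rw [← hχ U hU k (e 0), ← h, ← hπ i U hU t]
    rfl
  have hinj := Finite.injective_iff_surjective.mpr hsurj
  let τ := Equiv.ofBijective π ⟨hinj, hsurj⟩
  -- Both `L' i` and `L (τ.symm i)` are identified with the colour class of `i`.
  refine ⟨τ.symm, fun i => ?_⟩
  obtain ⟨f⟩ := χ.nonempty_iso_colorClass hη hc' (π := id) Function.injective_id hχ i
  obtain ⟨g⟩ := χ.nonempty_iso_colorClass hη hc hinj (fun U hU k s => hπ k U hU s) (τ.symm i)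
  have h : π (τ.symm i) = i := τ.apply_symm_apply i
  rw [h] at g
  exact ⟨f ≪≫ g.symm⟩

end OSet

end MonoidGeom

/-! ### Existence of a generic point. -/

namespace MonoidGeom

/-- The empty prime ideal. -/
def PrimeIdeal.empty (M : Type u) [CommMonoid M] : PrimeIdeal M where
  carrier := ∅
  mul_mem_left _ _ h := h
  one_notMem h := h
  mem_or_mem _ _ h := h.elim

/-- The empty prime omits every `f`, so it lies in every `D(f)`, and this passes to nonempty
intersections and unions. -/
theorem PrimeIdeal.empty_mem {M : Type u} [CommMonoid M] {U : Set (PrimeIdeal M)} (hU : IsOpen U)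
    (hne : U.Nonempty) : PrimeIdeal.empty M ∈ U := by
  induction hU with
  | basic s hs =>
    obtain ⟨f, rfl⟩ := hs
    exact fun h => h
  | univ => trivial
  | inter s t _ _ hs ht => exact ⟨hs (hne.mono Set.inter_subset_left),
      ht (hne.mono Set.inter_subset_right)⟩
  | sUnion S _ ih =>
    obtain ⟨x, s, hs, hx⟩ := hne
    exact ⟨s, hs, ih s hs ⟨x, hx⟩⟩

/-- A nonempty affine open set has a generic point. -/
theorem IsAffineOpen.exists_specializes {X : MonoidedSpace.{u}} {U : Opens X.carrier}
    (hU : IsAffineOpen X U) : ∃ η ∈ U, ∀ y ∈ U, η ⤳ y := by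
  obtain ⟨M, ⟨e⟩⟩ := hU
  let g : C(PrimeIdeal M, U) := e.inv.hom.base.hom
  let f : C(U, PrimeIdeal M) := e.hom.hom.base.hom
  have hgf : ∀ y, g (f y) = y := fun y => by
    have h := congrArg (fun k => k.hom.base) e.hom_inv_id
    exact ConcreteCategory.congr_hom h y
  refine ⟨(g (PrimeIdeal.empty M)).1, (g (PrimeIdeal.empty M)).2, fun y hy => ?_⟩
  rw [specializes_iff_forall_open]
  intro W hW hyW
  have hc : Continuous fun p => (g p).1 := continuous_subtype_val.comp g.continuous
  refine PrimeIdeal.empty_mem (hW.preimage hc) ⟨f ⟨y, hy⟩, ?_⟩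
  change (g (f ⟨y, hy⟩)).1 ∈ W
  rwa [hgf]

/-- A connected monoid scheme has a generic point. -/
theorem MonoidScheme.exists_isGeneric (X : MonoidScheme.{u}) [ConnectedSpace X.toSpace.carrier] :
    ∃ η : X.toSpace.carrier, IsGeneric η := by
  obtain ⟨x⟩ := (inferInstance : Nonempty X.toSpace.carrier)
  obtain ⟨U, -, hU⟩ := X.exists_affine x
  obtain ⟨η, hηU, -⟩ := hU.exists_specializes
  obtain ⟨V, hηV, hV⟩ := X.exists_affine η
  obtain ⟨ξ, hξ, hξV⟩ := hV.exists_specializes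
  refine ⟨ξ, fun W hW => Opens.ext (Set.eq_empty_of_forall_notMem fun y hy => hW ?_)⟩
  -- This is the closure of `ξ`. For openness, let `Z` be an affine neighbourhood of `y` with
  -- generic point `ζ`. Then `ξ ∈ Z`, so `ζ` specialises to `ξ` and lies in `V`; hence `ξ`
  -- specialises to `ζ`, and so to all of `Z`.
  have hclopen : IsClopen {y | ξ ⤳ y} := by
    constructor
    · simp only [specializes_iff_mem_closure]
      exact isClosed_closure
    · rw [isOpen_iff_forall_mem_open]
      intro y hy
      obtain ⟨Z, hyZ, hZ⟩ := X.exists_affine y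
      obtain ⟨ζ, hζ, hζZ⟩ := hZ.exists_specializes
      have hξZ : ξ ∈ Z := hy.mem_open Z.2 hyZ
      have hζV : ζ ∈ V := (hζZ ξ hξZ).mem_open V.2 hξ
      exact ⟨Z, fun z hz => (hξV ζ hζV).trans (hζZ z hz), Z.2, hyZ⟩
  have hy' : ξ ⤳ y := Set.eq_univ_iff_forall.mp (hclopen.eq_univ ⟨ξ, specializes_rfl⟩) y
  exact hy'.mem_open W.2 hy

/-! ### Passage to isomorphism classes and orbits. -/

/-- The bijection on sections given by an isomorphism. -/
def OSet.appEquiv {X : MonoidedSpace.{u}} {V W : OSet X} (f : V ≅ W) (U : Opens X.carrier) :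
    V.sec U ≃ W.sec U where
  toFun := OSet.Hom.app f.hom U
  invFun := OSet.Hom.app f.inv U
  left_inv s := by rw [← OSet.Hom.comp_app, f.hom_inv_id]; rfl
  right_inv s := by rw [← OSet.Hom.comp_app, f.inv_hom_id]; rfl

/-- Disjoint unions are invariant under isomorphism and reindexing. -/
theorem OSet.IsDisjointUnion.of_iso {X : MonoidedSpace.{u}} {η : X.carrier} {ι : Type}
    {L L' : ι → OSet X} {V V' : OSet X} {c : ∀ i, L i ⟶ V} (h : IsDisjointUnion η c)
    (σ : Equiv.Perm ι) (f : ∀ i, L' i ≅ L (σ i)) (g : V ≅ V') :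
    IsDisjointUnion η fun i => (f i).hom ≫ c (σ i) ≫ g.hom := fun U hU =>
  (appEquiv g U).bijective.comp
    ((h U hU).comp (Equiv.sigmaCongr σ fun i => appEquiv (f i) U).bijective)

open Limits in
theorem OSet.IsCoproduct.nonempty_iso {X : MonoidedSpace.{u}} {ι : Type} {L : ι → OSet X}
    {V V' : OSet X} (h : IsCoproduct L V) (h' : IsCoproduct L V') : Nonempty (V ≅ V') := by
  obtain ⟨c, ⟨hc⟩⟩ := h
  obtain ⟨c', ⟨hc'⟩⟩ := h'
  exact ⟨hc.coconePointUniqueUpToIso hc'⟩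

namespace MonoidScheme

variable {X : MonoidScheme.{u}} {n : ℕ}

theorem nonempty_iso_iff {V W : X.VectorBundle n} : Nonempty (V ≅ W) ↔ Nonempty (V.obj ≅ W.obj) :=
  ⟨fun ⟨e⟩ => ⟨(ObjectProperty.ι _).mapIso e⟩, fun ⟨e⟩ => ⟨ObjectProperty.isoMk _ e⟩⟩

theorem classOf_eq_iff {V W : X.VectorBundle n} : classOf V = classOf W ↔ Nonempty (V ≅ W) :=
  Quotient.eq

theorem orbitOf_eq_iff {L L' : Fin n → X.LineBundle} :
    orbitOf L = orbitOf L' ↔ ∃ σ : Equiv.Perm (Fin n), ∀ i, Nonempty (L i ≅ L' (σ i)) := by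
  refine (Quotient.eq (r := MulAction.orbitRel _ _)).trans ?_
  constructor
  · rintro ⟨σ, hσ⟩
    exact ⟨DomMulAct.mk.symm σ, fun i => classOf_eq_iff.mp (congrFun hσ i).symm⟩
  · rintro ⟨σ, hσ⟩
    exact ⟨DomMulAct.mk σ, funext fun i => (classOf_eq_iff.mpr (hσ i)).symm⟩

theorem exists_orbitOf_eq (o : X.PicOrbits n) : ∃ L : Fin n → X.LineBundle, orbitOf L = o := by
  obtain ⟨f, rfl⟩ := Quotient.exists_rep o
  choose L hL using fun i => Quotient.exists_rep (f i)
  exact ⟨L, congrArg _ (funext hL)⟩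

end MonoidScheme

/-- A relation that is functional in both directions defines a bijection. -/
theorem exists_equiv_of_existsUnique {α β : Type*} {R : α → β → Prop} (h : ∀ a, ∃! b, R a b)
    (h' : ∀ b, ∃! a, R a b) : ∃ e : α ≃ β, ∀ a b, e a = b ↔ R a b := by
  choose f hf hf' using h
  choose g hg hg' using h'
  exact ⟨⟨f, g, fun a => (hg' _ _ (hf a)).symm, fun b => (hf' _ _ (hg b)).symm⟩,
    fun a b => ⟨fun e => e ▸ hf a, fun r => (hf' a b r).symm⟩⟩

end MonoidGeom
theorem mainTheorem1 (X : MonoidGeom.MonoidScheme.{u}) (hconn : ConnectedSpace X.toSpace.carrier)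
    (hsep : X.IsSeparated) (n : ℕ) :
    (∀ V : X.VectorBundle n, ∃ L : Fin n → X.LineBundle,
        MonoidGeom.MonoidScheme.IsCoproductOf V L) ∧
    (∀ (V : X.VectorBundle n) (L L' : Fin n → X.LineBundle),
        MonoidGeom.MonoidScheme.IsCoproductOf V L → MonoidGeom.MonoidScheme.IsCoproductOf V L' →
        ∃ σ : Equiv.Perm (Fin n), ∀ i, Nonempty (L' i ≅ L (σ i))) ∧
    (∃ e : X.PicOrbits n ≃ X.Vect n, ∀ (L : Fin n → X.LineBundle) (V : X.VectorBundle n),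
        e (MonoidGeom.MonoidScheme.orbitOf L) = MonoidGeom.MonoidScheme.classOf V ↔
          MonoidGeom.MonoidScheme.IsCoproductOf V L) := by

  obtain ⟨η, hη⟩ := X.exists_isGeneric
  have h1 : ∀ V : X.VectorBundle n, ∃ L : Fin n → X.LineBundle,
      MonoidGeom.MonoidScheme.IsCoproductOf V L := fun V => by
    obtain ⟨L, c, hL, hc⟩ := V.property.exists_isDisjointUnion hη
    exact ⟨fun i => ⟨L i, hL i⟩, (MonoidGeom.OSet.isCoproduct_iff hη).mpr ⟨c, hc⟩⟩
  have h2 : ∀ (V : X.VectorBundle n) (L L' : Fin n → X.LineBundle),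
      MonoidGeom.MonoidScheme.IsCoproductOf V L → MonoidGeom.MonoidScheme.IsCoproductOf V L' →
        ∃ σ : Equiv.Perm (Fin n), ∀ i, Nonempty (L' i ≅ L (σ i)) := fun V L L' h h' => by
    obtain ⟨c, hc⟩ := (MonoidGeom.OSet.isCoproduct_iff hη).mp h
    obtain ⟨c', hc'⟩ := (MonoidGeom.OSet.isCoproduct_iff hη).mp h'
    obtain ⟨σ, hσ⟩ := hc.exists_perm hη hc' (fun i => (L i).property) fun i => (L' i).property
    exact ⟨σ, fun i => MonoidGeom.MonoidScheme.nonempty_iso_iff.mpr (hσ i)⟩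
  have h3 : ∀ L : Fin n → X.LineBundle, ∃ V : X.VectorBundle n,
      MonoidGeom.MonoidScheme.IsCoproductOf V L := fun L => by
    have hc := MonoidGeom.OSet.isDisjointUnion_coprodι hη fun i => (L i).obj
    exact ⟨⟨_, hc.isVectorBundle hη fun i => (L i).property⟩,
      (MonoidGeom.OSet.isCoproduct_iff hη).mpr ⟨_, hc⟩⟩
  -- Being a coproduct depends only on the orbit of `L` and the class of `V`, so it descends to a
  -- relation on the quotients.
  have h4 : ∀ {L L' : Fin n → X.LineBundle} {V V' : X.VectorBundle n},
      MonoidGeom.MonoidScheme.orbitOf L = MonoidGeom.MonoidScheme.orbitOf L' →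
      MonoidGeom.MonoidScheme.classOf V = MonoidGeom.MonoidScheme.classOf V' →
      MonoidGeom.MonoidScheme.IsCoproductOf V L → MonoidGeom.MonoidScheme.IsCoproductOf V' L' := by
    intro L L' V V' hL hV h
    obtain ⟨σ, hσ⟩ := MonoidGeom.MonoidScheme.orbitOf_eq_iff.mp hL.symm
    obtain ⟨g⟩ := MonoidGeom.MonoidScheme.nonempty_iso_iff.mp
      (MonoidGeom.MonoidScheme.classOf_eq_iff.mp hV)
    obtain ⟨c, hc⟩ := (MonoidGeom.OSet.isCoproduct_iff hη).mp h
    exact (MonoidGeom.OSet.isCoproduct_iff hη).mpr ⟨_, hc.of_iso σ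
      (fun i => (MonoidGeom.MonoidScheme.nonempty_iso_iff.mp (hσ i)).some) g⟩
  refine ⟨h1, h2, ?_⟩
  -- From orbits to classes, `h3` gives existence and uniqueness of colimits gives uniqueness; in
  -- the other direction these are `h1` and `h2`.
  obtain ⟨e, he⟩ := MonoidGeom.exists_equiv_of_existsUnique
    (R := fun (o : X.PicOrbits n) (v : X.Vect n) => ∃ L V,
      MonoidGeom.MonoidScheme.orbitOf L = o ∧ MonoidGeom.MonoidScheme.classOf V = v ∧
        MonoidGeom.MonoidScheme.IsCoproductOf V L)
    (fun o => by
      obtain ⟨L, rfl⟩ := MonoidGeom.MonoidScheme.exists_orbitOf_eq o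
      obtain ⟨V, hV⟩ := h3 L
      refine ⟨_, ⟨L, V, rfl, rfl, hV⟩, ?_⟩
      rintro _ ⟨L', V', hL, rfl, h⟩
      exact MonoidGeom.MonoidScheme.classOf_eq_iff.mpr
        (MonoidGeom.MonoidScheme.nonempty_iso_iff.mpr
          (MonoidGeom.OSet.IsCoproduct.nonempty_iso (h4 hL rfl h) hV)))
    (fun v => by
      obtain ⟨V, rfl⟩ := Quotient.exists_rep v
      obtain ⟨L, hL⟩ := h1 V
      refine ⟨_, ⟨L, V, rfl, rfl, hL⟩, ?_⟩
      rintro _ ⟨L', V', rfl, hV, h⟩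
      exact MonoidGeom.MonoidScheme.orbitOf_eq_iff.mpr (h2 V L L' hL (h4 rfl hV h)))
  refine ⟨e, fun L V => (he _ _).trans ⟨?_, fun h => ⟨L, V, rfl, rfl, h⟩⟩⟩
  rintro ⟨L', V', hL, hV, h⟩
  exact h4 hL hV h
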